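/- Let $n\ge 1$, let $\mathbb F_n^+$ be the unital free semigroup on generators $g_1,\dots,g_n$ with identity $g_0$, and let $F^2(H_n)$ be the full Fock space on $n$ generators, with orthonormal basis $(e_\alpha)_{\alpha\in\mathbb F_n^+}$. Let $f=\sum_{\alpha}a_\alpha X_\alpha$ be a positive regular free holomorphic function: $a_\alpha\ge 0$ for all $\alpha$, $a_{g_0}=0$, $a_{g_i}>0$ for $i=1,\dots,n$, and $\limsup_{k\to\infty}\big(\sum_{|\alpha|=k}|a_\alpha|^2\big)^{1/2k}<\infty$. Put $b_{g_0}=1$ and $$b_\alpha=\sum_{j=1}^{|\alpha|}\ \sum_{\gamma_1\cdots\gamma_j=\alpha,\ |\gamma_1|\ge1,\dots,|\gamma_j|\ge 1}a_{\gamma_1}\cdots a_{\gamma_j}\qquad(|\alpha|\ge1),$$ and let $W_1,\dots,W_n$ be the weighted left creation operators on $F^2(H_n)$ associated with the noncommutative domain $\mathcal D_f$, i.e. the bounded operators with $W_ie_\alpha=\sqrt{b_\alpha/b_{g_i\alpha}}\;e_{g_i\alpha}$. For $\alpha=g_{i_1}\cdots g_{i_k}$ write $W_\alpha=W_{i_1}\cdots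 W_{i_k}$. For Hilbert spaces $\mathcal E,\mathcal H$, a bounded operator $\Psi:F^2(H_n)\otimes\mathcal E\to F^2(H_n)\otimes\mathcal H$ is called multi-analytic if $\Psi(W_i\otimes I_{\mathcal E})=(W_i\otimes I_{\mathcal H})\Psi$ for $i=1,\dots,n$, and inner if it is multi-analytic and a partial isometry. Let $\mathcal H$ be a complex Hilbert space. Then the following hold. (1) For every bounded operator $Y$ on $F^2(H_n)\otimes\mathcal H$ the series $$\Phi_{f,W\otimes I}(Y)=\sum_{|\alpha|\ge1}a_\alpha\,(W_\alpha\otimes I_{\mathcal H})\,Y\,(W_\alpha\otimes I_{\mathcal H})^*$$ converges (unconditionally) in the weak operator topology, and the following are equivalent: (i) there are a Hilbert space $\mathcal E$ and a multi-analytic operator $\Psi:F^2(H_n)\otimes\mathcal E\to F^2(H_n)\otimes\mathcal H$ with $Y=\Psi\Psi^*$; (ii) $\Phi_{f,W\otimes I}(Y)\le Y$. (2) A closed subspace $\mathcal M\subseteq F^2(H_n)\otimes\mathcal H$ is invariant under each of the operators $W_1\otimes I_{\mathcal H},\dots,W_n\otimes I_{\mathcal H}$ if and only if there are a Hilbert space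 $\mathcal E$ and an inner multi-analytic operator $\Psi:F^2(H_n)\otimes\mathcal E\to F^2(H_n)\otimes\mathcal H$ such that $\mathcal M=\Psi[F^2(H_n)\otimes\mathcal E]$. -/

import Mathlib

open scoped TensorProduct ENNReal InnerProductSpace

universe u

noncomputable section

namespace NCDomain

/-! ### Hilbert tensor products -/

/-- The Hilbert space tensor product: the completion of the algebraic tensor product with respect
to the inner product `⟪x ⊗ y, x' ⊗ y'⟫ = ⟪x, x'⟫ * ⟪y, y'⟫`. -/
abbrev HilbertTensor (E F : Type*) [NormedAddCommGroup E] [InnerProductSpace ℂ E]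
    [NormedAddCommGroup F] [InnerProductSpace ℂ F] : Type _ :=
  UniformSpace.Completion (E ⊗[ℂ] F)

/-- The operator `T ⊗ I_F` on the Hilbert tensor product `E ⊗ F`. -/
def ampliation {E : Type*} [NormedAddCommGroup E] [InnerProductSpace ℂ E]
    (F : Type*) [NormedAddCommGroup F] [InnerProductSpace ℂ F] (T : E →L[ℂ] E) :
    HilbertTensor E F →L[ℂ] HilbertTensor E F :=
  (T.rTensor F).completion

/-! ### Words, the full Fock space and positive regular free holomorphic functions -/

/-- The free monoid on `n` generators `g_0, …, g_{n-1}`: words are lists of indices, the product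
is concatenation, the unit is `[]`, and the length of a word is the length of the list. -/
abbrev Word (n : ℕ) : Type := List (Fin n)

/-- The full Fock space on `n` generators, identified with `ℓ²` of the free monoid through its
orthonormal basis `e_α = e_{i₁} ⊗ ⋯ ⊗ e_{iₖ}`, where `α = g_{i₁} ⋯ g_{iₖ}`. -/
abbrev Fock (n : ℕ) : Type := lp (fun _ : Word n => ℂ) 2

/-- The basis vector `e_α` of the Fock space; `e_[]` is the vacuum vector `1`. -/
def e {n : ℕ} (α : Word n) : Fock n := lp.single 2 α (1 : ℂ)

theorem orthonormal_e (n : ℕ) : Orthonormal ℂ (e : Word n → Fock n) := by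
  classical
  rw [orthonormal_iff_ite]
  intro α β
  by_cases h : α = β
  · subst h
    simp [e]
  · simp [e, lp.inner_single_left, h]

theorem cons_orthonormal {n : ℕ} (i : Fin n) :
    Orthonormal ℂ (fun α : Word n => (e (i :: α) : Fock n)) :=
  (orthonormal_e n).comp _ (List.cons_injective (a := i))

/-- The left creation operator `S_i`, the isometry with `S_i e_α = e_{g_i α}`. -/
def S {n : ℕ} (i : Fin n) : Fock n →L[ℂ] Fock n :=
  (cons_orthonormal i).orthogonalFamily.linearIsometry.toContinuousLinearMap

theorem S_e {n : ℕ} (i : Fin n) (α : Word n) : S i (e α) = e (i :: α) := by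
  refine ((cons_orthonormal i).orthogonalFamily.linearIsometry_apply_single (1 : ℂ)).trans ?_
  simp

/-- A positive regular free holomorphic function `f = ∑ a_α X_α` in `n` noncommuting variables,
given by its family of coefficients. -/
structure PositiveRegular (n : ℕ) where
  /-- the coefficients `a_α` -/
  a : Word n → ℝ
  a_nonneg : ∀ α, 0 ≤ a α
  a_nil : a [] = 0
  a_gen_pos : ∀ i, 0 < a [i]
  /-- the radius of convergence is positive:
  `limsup_k (∑_{|α| = k} |a_α|²)^{1/(2k)} < ∞` -/
  radius_pos : Filter.limsup (fun k : ℕ => ENNReal.ofReal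
      ((∑ α : Fin k → Fin n, |a (List.ofFn α)| ^ 2) ^ (1 / (2 * (k : ℝ))))) Filter.atTop < ⊤

namespace PositiveRegular

variable {n : ℕ} (f : PositiveRegular n)

/-- The coefficients `b_α` of `(1 - f)⁻¹ = 1 + f + f² + ⋯`: the sum of `a_{γ₁} ⋯ a_{γⱼ}` over all
factorizations `α = γ₁ ⋯ γⱼ` into nonempty words. These correspond to the compositions of the
integer `|α|`; for the empty word there is only the empty factorization, so `b_[] = 1`. -/
def b (α : Word n) : ℝ :=
  ∑ c : Composition α.length, ((α.splitWrtComposition c).map f.a).prod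

theorem b_nil : f.b [] = 1 := by
  have h' : ∀ c : Composition ([] : Word n).length,
      ((([] : Word n).splitWrtComposition c).map f.a).prod = 1 := by
    intro c
    have h : c.blocks = [] := List.length_eq_zero_iff.1 (Nat.le_zero.1 c.length_le)
    unfold List.splitWrtComposition
    rw [h]
    rfl
  have hc : Fintype.card (Composition ([] : Word n).length) = 1 := composition_card 0
  unfold b
  rw [Finset.sum_congr rfl fun c _ => h' c, Finset.sum_const, Finset.card_univ, hc, one_smul]

theorem b_nonneg (α : Word n) : 0 ≤ f.b α :=
  Finset.sum_nonneg fun c _ => List.prod_nonneg (by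
    intro x hx
    obtain ⟨γ, -, rfl⟩ := List.mem_map.1 hx
    exact f.a_nonneg γ)

theorem a_mul_b_le (i : Fin n) (α : Word n) : f.a [i] * f.b α ≤ f.b (i :: α) := by
  let g : Composition α.length → Composition (i :: α).length := fun c =>
    { blocks := 1 :: c.blocks
      blocks_pos := by
        intro j hj
        rcases List.mem_cons.1 hj with rfl | hj
        · exact one_pos
        · exact c.blocks_pos hj
      blocks_sum := by simp [c.blocks_sum, add_comm] }
  have hg : Function.Injective g := by
    intro c c' h
    have h1 : 1 :: c.blocks = 1 :: c'.blocks := congrArg Composition.blocks h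
    exact Composition.ext (List.cons.inj h1).2
  have hval : ∀ c, (((i :: α).splitWrtComposition (g c)).map f.a).prod
      = f.a [i] * ((α.splitWrtComposition c).map f.a).prod := by
    intro c
    simp [List.splitWrtComposition, g, List.splitWrtCompositionAux_cons]
  unfold b
  rw [Finset.mul_sum, ← Finset.sum_congr rfl fun c _ => hval c,
    ← Finset.sum_image (s := Finset.univ) (g := g)
      (f := fun c => (((i :: α).splitWrtComposition c).map f.a).prod) hg.injOn]
  refine Finset.sum_le_sum_of_subset_of_nonneg (Finset.subset_univ _) fun c _ _ => ?_
  refine List.prod_nonneg fun x hx => ?_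
  obtain ⟨γ, -, rfl⟩ := List.mem_map.1 hx
  exact f.a_nonneg γ

theorem b_pos (α : Word n) : 0 < f.b α := by
  induction α with
  | nil => simp [b_nil]
  | cons i α ih => exact (mul_pos (f.a_gen_pos i) ih).trans_le (f.a_mul_b_le i α)

theorem norm_weight_le (i : Fin n) (α : Word n) :
    ‖((√(f.b α / f.b (i :: α)) : ℝ) : ℂ) • ContinuousLinearMap.id ℂ ℂ‖ ≤ √(1 / f.a [i]) := by
  rw [norm_smul, ContinuousLinearMap.norm_id, mul_one, Complex.norm_real, Real.norm_eq_abs,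
    abs_of_nonneg (Real.sqrt_nonneg _)]
  apply Real.sqrt_le_sqrt
  rw [div_le_div_iff₀ (f.b_pos _) (f.a_gen_pos i), one_mul, mul_comm]
  exact f.a_mul_b_le i α

/-- The diagonal operator `D_i` with `D_i e_α = √(b_α / b_{g_i α}) e_α`. -/
def D (i : Fin n) : Fock n →L[ℂ] Fock n :=
  lp.mapCLM 2 (fun α : Word n => ((√(f.b α / f.b (i :: α)) : ℝ) : ℂ) • ContinuousLinearMap.id ℂ ℂ)
    (Real.sqrt_nonneg (1 / f.a [i])) (f.norm_weight_le i)

/-- The weighted left creation operator `W_i = S_i D_i` associated with the noncommutative domain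
defined by `f`. -/
def W (i : Fin n) : Fock n →L[ℂ] Fock n := S i ∘L f.D i

theorem W_e (i : Fin n) (α : Word n) :
    f.W i (e α) = ((√(f.b α / f.b (i :: α)) : ℝ) : ℂ) • e (i :: α) := by
  have h : f.D i (e α) = ((√(f.b α / f.b (i :: α)) : ℝ) : ℂ) • e α := by
    ext β
    rw [lp.coeFn_smul, Pi.smul_apply]
    by_cases hβ : β = α
    · subst hβ
      simp [D, e]
    · simp [D, e, hβ]
  rw [W, ContinuousLinearMap.comp_apply, h, map_smul, S_e]

/-- `W_α = W_{i₁} ⋯ W_{iₖ}` for the word `α = g_{i₁} ⋯ g_{iₖ}`. -/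
def Wword (α : Word n) : Fock n →L[ℂ] Fock n := (α.map f.W).prod

/-- The terms `a_α (W_α ⊗ I) Y (W_α ⊗ I)^*` of the series defining `Φ_{f, W ⊗ I}(Y)`, as elements
of the space of bounded operators with the weak operator topology. The term of the empty word
vanishes because `a_[] = 0`. -/
def PhiTerm {H : Type*} [NormedAddCommGroup H] [InnerProductSpace ℂ H]
    (Y : HilbertTensor (Fock n) H →L[ℂ] HilbertTensor (Fock n) H) (α : Word n) :
    HilbertTensor (Fock n) H →WOT[ℂ] HilbertTensor (Fock n) H :=
  ContinuousLinearMapWOT.ofCLM (((f.a α : ℝ) : ℂ) •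
    (ampliation H (f.Wword α) ∘L Y ∘L
      ContinuousLinearMap.adjoint (ampliation H (f.Wword α))))

/-- `Φ_{f, W ⊗ I}(Y) = ∑_{|α| ≥ 1} a_α (W_α ⊗ I) Y (W_α ⊗ I)^*`, the series being summed in the
weak operator topology. -/
def Phi {H : Type*} [NormedAddCommGroup H] [InnerProductSpace ℂ H]
    (Y : HilbertTensor (Fock n) H →L[ℂ] HilbertTensor (Fock n) H) :
    HilbertTensor (Fock n) H →L[ℂ] HilbertTensor (Fock n) H :=
  (∑' α, f.PhiTerm Y α).toCLM

/-- A bounded operator `Ψ : F² ⊗ E → F² ⊗ H` is multi-analytic with respect to `W_1, …, W_n` if it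
intertwines `W_i ⊗ I_E` and `W_i ⊗ I_H` for every `i`. -/
def IsMultiAnalytic {E H : Type*} [NormedAddCommGroup E] [InnerProductSpace ℂ E]
    [NormedAddCommGroup H] [InnerProductSpace ℂ H]
    (Ψ : HilbertTensor (Fock n) E →L[ℂ] HilbertTensor (Fock n) H) : Prop :=
  ∀ i, Ψ ∘L ampliation E (f.W i) = ampliation H (f.W i) ∘L Ψ

/-- An inner operator is a multi-analytic operator that is a partial isometry, that is, isometric
on the orthogonal complement of its kernel. -/
def IsInner {E H : Type*} [NormedAddCommGroup E] [InnerProductSpace ℂ E]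
    [NormedAddCommGroup H] [InnerProductSpace ℂ H]
    (Ψ : HilbertTensor (Fock n) E →L[ℂ] HilbertTensor (Fock n) H) : Prop :=
  f.IsMultiAnalytic Ψ ∧ ∀ x ∈ (LinearMap.ker Ψ.toLinearMap)ᗮ, ‖Ψ x‖ = ‖x‖

end PositiveRegular

end NCDomain

end

noncomputable section

/-! The coefficients `b` are those of `(1 - f)⁻¹`, so splitting off the first or last factor gives
`b = δ + a * b = δ + b * a` for the convolution over factorizations of words, `δ` being the
indicator of the empty word. Both parts rest on these two identities.

Write `V_α = W_α ⊗ I`. In coordinates, `V_α^* x` has `β`-entry `√(b_β / b_{αβ}) x_{αβ}`. Grouping by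
`δ = αβ` and using `b = δ + a * b`, the row `(√a_α V_α)` is a contraction
(`sum_norm_adjoint_V_sq_le`). This yields weak convergence of `Φ(Y)`, and `Φ(ΨΨ^*) ≤ ΨΨ^*` because
`Ψ^*` intertwines the adjoints.

Conversely, if `Y - Φ(Y) = R^* R`, let `B x` have coordinates `√b_α R V_α^* x`. The identity `b - b
* a = δ` gives `∑ b_α ⟨V_α^* x, (Y - Φ(Y)) V_α^* x⟩ = ⟨x, Y x⟩` for finitely supported `x`
(`sum_b_mul_inner_sub_Phi`); all sums are finite there, and density gives `Y = B^* B`. Positivity of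
`Y` is a by-product. The weights make `Ψ = B^*` multi-analytic.

For an invariant subspace, the projection `P` onto it satisfies `Φ(P) ≤ P`; a factorization `P =
ΨΨ^*` forces `Ψ` to be a partial isometry with range the subspace. -/

theorem List.splitWrtCompositionAux_append_singleton {α : Type*} (l : List α) (ns : List ℕ)
    (m : ℕ) :
    l.splitWrtCompositionAux (ns ++ [m]) =
      (l.take ns.sum).splitWrtCompositionAux ns ++ [(l.drop ns.sum).take m] := by
  induction ns generalizing l with
  | nil => simp [List.splitWrtCompositionAux_cons, List.splitWrtCompositionAux]
  | cons k ns ih =>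
    simp only [List.cons_append, List.splitWrtCompositionAux_cons, ih, List.sum_cons,
      List.drop_drop, List.take_take, List.drop_take]
    simp

namespace NCDomain

/-! ### Convolution identities for the coefficients of `(1 - f)⁻¹`. -/

namespace PositiveRegular

variable {n : ℕ} (f : PositiveRegular n)

/-- Coefficient form of `(1 - f)⁻¹ = 1 + f (1 - f)⁻¹`: compositions are sorted by their first block,
of size `k + 1`. -/
theorem b_eq_sum_first {γ : Word n} (hγ : γ ≠ []) :
    f.b γ = ∑ k ∈ Finset.range γ.length, f.a (γ.take (k + 1)) * f.b (γ.drop (k + 1)) := by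
  simp only [b, Finset.mul_sum]
  rw [Finset.sum_sigma']
  symm
  refine Finset.sum_bij
    (fun (p : Σ k : ℕ, Composition (γ.drop (k + 1)).length) hp =>
      (⟨(p.1 + 1) :: p.2.blocks, ?_, ?_⟩ : Composition γ.length)) ?_ ?_ ?_ ?_
  · intro j hj
    rcases List.mem_cons.1 hj with rfl | hj
    · omega
    · exact p.2.blocks_pos hj
  · have := List.mem_range.1 (by simpa using hp : p.1 ∈ List.range γ.length)
    rw [List.sum_cons, p.2.blocks_sum, List.length_drop]
    omega
  · intros; exact Finset.mem_univ _
  · rintro ⟨k, c⟩ h ⟨k', c'⟩ h' heq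
    have heq := congrArg Composition.blocks heq
    simp only [List.cons.injEq] at heq
    obtain rfl : k = k' := by omega
    rw [Composition.ext heq.2]
  · intro c _
    have hc : c.blocks ≠ [] := by
      intro h
      have := c.blocks_sum
      rw [h] at this
      exact hγ (List.length_eq_zero_iff.1 this.symm)
    obtain ⟨m, ns, hm⟩ := List.exists_cons_of_ne_nil hc
    have hpos : 0 < m := c.blocks_pos (by simp [hm])
    have hsum := c.blocks_sum
    rw [hm, List.sum_cons] at hsum
    obtain ⟨k, rfl⟩ : ∃ k, m = k + 1 := ⟨m - 1, by omega⟩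
    refine ⟨⟨k, ⟨ns, fun h => c.blocks_pos (by simp [hm, h]), ?_⟩⟩, ?_, ?_⟩
    · rw [List.length_drop]; omega
    · simp; omega
    · exact Composition.ext hm.symm
  · rintro ⟨k, c⟩ h
    simp [List.splitWrtComposition, List.splitWrtCompositionAux_cons]

/-- Coefficient form of `(1 - f)⁻¹ = 1 + (1 - f)⁻¹ f`: compositions are sorted by the position `k`
where the last block begins. -/
theorem b_eq_sum_last {γ : Word n} (hγ : γ ≠ []) :
    f.b γ = ∑ k ∈ Finset.range γ.length, f.b (γ.take k) * f.a (γ.drop k) := by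
  simp only [b, Finset.sum_mul]
  rw [Finset.sum_sigma']
  symm
  refine Finset.sum_bij
    (fun (p : Σ k : ℕ, Composition (γ.take k).length) hp =>
      (⟨p.2.blocks ++ [γ.length - p.1], ?_, ?_⟩ : Composition γ.length)) ?_ ?_ ?_ ?_
  · have := List.mem_range.1 (by simpa using hp : p.1 ∈ List.range γ.length)
    intro j hj
    rcases List.mem_append.1 hj with hj | hj
    · exact p.2.blocks_pos hj
    · rw [List.mem_singleton.1 hj]; omega
  · have := List.mem_range.1 (by simpa using hp : p.1 ∈ List.range γ.length)
    rw [List.sum_append, p.2.blocks_sum, List.length_take, List.sum_singleton]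
    omega
  · intros; exact Finset.mem_univ _
  · rintro ⟨k, c⟩ h ⟨k', c'⟩ h' heq
    have heq := congrArg Composition.blocks heq
    simp only [List.append_singleton_inj] at heq
    simp only [Finset.mem_sigma, Finset.mem_range] at h h'
    obtain rfl : k = k' := by omega
    rw [Composition.ext heq.1]
  · intro c _
    have hc : c.blocks ≠ [] := by
      intro h
      have := c.blocks_sum
      rw [h] at this
      exact hγ (List.length_eq_zero_iff.1 this.symm)
    obtain ⟨ns, m, hm⟩ := (List.eq_nil_or_concat c.blocks).resolve_left hc
    have hpos : 0 < m := c.blocks_pos (by simp [hm])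
    have hsum := c.blocks_sum
    rw [List.concat_eq_append] at hm
    rw [hm, List.sum_append, List.sum_singleton] at hsum
    refine ⟨⟨ns.sum, ⟨ns, fun h => c.blocks_pos (by simp [hm, h]), ?_⟩⟩, ?_, ?_⟩
    · rw [List.length_take]; omega
    · simp; omega
    · refine Composition.ext ?_
      have hm' : γ.length - ns.sum = m := by omega
      exact (congrArg (fun j => ns ++ [j]) hm').trans hm.symm
  · rintro ⟨k, c⟩ h
    have hk : k < γ.length := by simpa using h
    have hs : c.blocks.sum = k := by rw [c.blocks_sum, List.length_take]; omega
    simp only [List.splitWrtComposition, List.splitWrtCompositionAux_append_singleton, hs]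
    rw [List.take_of_length_le (l := γ.drop k) (by simp)]
    simp

end PositiveRegular

/-- The finite set of words of length less than `N`. -/
def wordsLT (n N : ℕ) : Finset (Word n) := (List.finite_length_lt (Fin n) N).toFinset

@[simp]
theorem mem_wordsLT {n N : ℕ} {α : Word n} : α ∈ wordsLT n N ↔ α.length < N := by
  simp [wordsLT]

/-- Summation over the factorizations `δ = αβ` of short words. -/
theorem sum_wordsLT_splits {n : ℕ} {M : Type*} [AddCommMonoid M] (N : ℕ)
    (g : Word n → Word n → M) :
    ∑ δ ∈ wordsLT n N, ∑ k ∈ Finset.range (δ.length + 1), g (δ.take k) (δ.drop k) =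
      ∑ p ∈ (wordsLT n N ×ˢ wordsLT n N).filter (fun p => p.1.length + p.2.length < N),
        g p.1 p.2 := by
  rw [Finset.sum_sigma']
  refine Finset.sum_nbij' (fun p => (p.1.take p.2, p.1.drop p.2))
    (fun p => ⟨p.1 ++ p.2, p.1.length⟩) ?_ ?_ ?_ ?_ ?_
  · rintro ⟨δ, k⟩ h
    simp only [Finset.mem_sigma, mem_wordsLT, Finset.mem_range] at h
    simp
    omega
  · rintro ⟨α, β⟩ h
    simp only [Finset.mem_filter, Finset.mem_product, mem_wordsLT] at h
    simp
    omega
  · rintro ⟨δ, k⟩ h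
    simp only [Finset.mem_sigma, mem_wordsLT, Finset.mem_range] at h
    simp
    omega
  · rintro ⟨α, β⟩ h
    simp
  · intros; rfl

namespace PositiveRegular

variable {n : ℕ} (f : PositiveRegular n)

theorem sum_splits_first (δ : Word n) :
    ∑ k ∈ Finset.range (δ.length + 1), f.a (δ.take k) * f.b (δ.drop k) =
      if δ = [] then 0 else f.b δ := by
  rw [Finset.sum_range_succ']
  split_ifs with h
  · simp [h, f.a_nil]
  · simp [f.a_nil, f.b_eq_sum_first h]

theorem sum_splits_last (δ : Word n) :
    ∑ k ∈ Finset.range (δ.length + 1), f.b (δ.take k) * f.a (δ.drop k) =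
      if δ = [] then 0 else f.b δ := by
  rw [Finset.sum_range_succ]
  split_ifs with h
  · simp [h, f.a_nil]
  · simp [f.a_nil, f.b_eq_sum_last h]

end PositiveRegular

/-! ### Coordinates on `F² ⊗ E` as square summable families indexed by words. -/

section Coordinates

variable {n : ℕ} (E : Type*) [NormedAddCommGroup E] [InnerProductSpace ℂ E]

/-- The embedding `v ↦ e_α ⊗ v` of `E` into `F² ⊗ E`. -/
def basisTensor (α : Word n) : E →ₗᵢ[ℂ] HilbertTensor (Fock n) E where
  toFun v := ((e α ⊗ₜ[ℂ] v : Fock n ⊗[ℂ] E) : HilbertTensor (Fock n) E)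
  map_add' v w := by rw [TensorProduct.tmul_add, UniformSpace.Completion.coe_add]
  map_smul' c v := by
    rw [TensorProduct.tmul_smul, UniformSpace.Completion.coe_smul, RingHom.id_apply]
  norm_map' v := by
    simp [TensorProduct.norm_tmul, (orthonormal_e n).1 α]

variable {E}

theorem basisTensor_apply (α : Word n) (v : E) :
    basisTensor E α v = ((e α ⊗ₜ[ℂ] v : Fock n ⊗[ℂ] E) : HilbertTensor (Fock n) E) := rfl

theorem ampliation_coe_tmul (T : Fock n →L[ℂ] Fock n) (x : Fock n) (v : E) :
    ampliation E T ((x ⊗ₜ[ℂ] v : Fock n ⊗[ℂ] E) : HilbertTensor (Fock n) E) =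
      ((T x ⊗ₜ[ℂ] v : Fock n ⊗[ℂ] E) : HilbertTensor (Fock n) E) := by
  rw [ampliation, ContinuousLinearMap.completion_apply_coe, ContinuousLinearMap.rTensor_tmul]

theorem ampliation_mul (T T' : Fock n →L[ℂ] Fock n) :
    ampliation E (T * T') = ampliation E T ∘L ampliation E T' := by
  ext x
  induction x using UniformSpace.Completion.induction_on with
  | hp => exact isClosed_eq (by fun_prop) (by fun_prop)
  | ih x =>
    simp [ampliation, ContinuousLinearMap.completion_apply_coe, ContinuousLinearMap.rTensor_mul]

theorem ampliation_one :
    ampliation E (1 : Fock n →L[ℂ] Fock n) = ContinuousLinearMap.id ℂ _ := by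
  ext x
  induction x using UniformSpace.Completion.induction_on with
  | hp => exact isClosed_eq (by fun_prop) (by fun_prop)
  | ih x => simp [ampliation, ContinuousLinearMap.completion_apply_coe]

variable (E) in
theorem basisTensor_orthogonalFamily :
    OrthogonalFamily ℂ (fun _ : Word n => E) (basisTensor E) := by
  intro α β h v w
  simp [basisTensor_apply, (orthonormal_e n).2 h]

/-- Each `x ⊗ v` is a limit of finite sums of vectors `e_α ⊗ (x_α v)`, and algebraic tensors are
dense. -/
theorem eq_top_of_basisTensor_mem (K : Submodule ℂ (HilbertTensor (Fock n) E))
    (hK : IsClosed (K : Set (HilbertTensor (Fock n) E)))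
    (h : ∀ α v, basisTensor E α v ∈ K) : K = ⊤ := by
  have htmul : ∀ (x : Fock n) (v : E),
      ((x ⊗ₜ[ℂ] v : Fock n ⊗[ℂ] E) : HilbertTensor (Fock n) E) ∈ K := by
    intro x v
    have hcont : Continuous fun x : Fock n =>
        ((x ⊗ₜ[ℂ] v : Fock n ⊗[ℂ] E) : HilbertTensor (Fock n) E) :=
      (UniformSpace.Completion.continuous_coe _).comp
        (TensorProduct.continuous_tmul.comp (by fun_prop : Continuous fun x : Fock n => (x, v)))
    have hsum := lp.hasSum_single (p := 2) (by norm_num) x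
    refine (hK.preimage hcont).mem_of_tendsto hsum (Filter.Eventually.of_forall fun s => ?_)
    rw [Set.mem_preimage, TensorProduct.sum_tmul]
    have := K.sum_mem (t := s) (f := fun α => basisTensor E α ((x α) • v)) fun α _ => h α _
    convert! this
    rw [← UniformSpace.Completion.coe_toComplL (𝕜 := ℂ), map_sum]
    refine Finset.sum_congr rfl fun α _ => ?_
    rw [UniformSpace.Completion.coe_toComplL, basisTensor_apply, ← TensorProduct.smul_tmul, e,
      ← lp.single_smul]
    simp
  rw [eq_top_iff]
  rintro x -
  induction x using UniformSpace.Completion.induction_on with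
  | hp => exact hK
  | ih x =>
    induction x using TensorProduct.induction_on with
    | zero => exact K.zero_mem
    | tmul x v => exact htmul x v
    | add x y hx hy =>
      rw [UniformSpace.Completion.coe_add]
      exact K.add_mem hx hy

variable [CompleteSpace E]

variable (n E) in
theorem basisTensor_isHilbertSum :
    IsHilbertSum ℂ (fun _ : Word n => E) (basisTensor E) := by
  refine IsHilbertSum.mk (basisTensor_orthogonalFamily E) (top_le_iff.2 ?_)
  refine eq_top_of_basisTensor_mem _ (Submodule.isClosed_topologicalClosure _) fun α v => ?_
  exact Submodule.le_topologicalClosure _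
    (Submodule.mem_iSup_of_mem α (LinearMap.mem_range_self _ v))

variable (n E) in
/-- The identification of `F² ⊗ E` with the space of square summable families in `E`. -/
def coord : HilbertTensor (Fock n) E ≃ₗᵢ[ℂ] lp (fun _ : Word n => E) 2 :=
  (basisTensor_isHilbertSum n E).linearIsometryEquiv

theorem coord_basisTensor (α : Word n) (v : E) :
    coord n E (basisTensor E α v) = lp.single 2 α v := by
  rw [← LinearIsometryEquiv.eq_symm_apply]
  exact ((basisTensor_isHilbertSum n E).linearIsometryEquiv_symm_apply_single v).symm

theorem inner_basisTensor (α : Word n) (v : E) (x : HilbertTensor (Fock n) E) :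
    ⟪basisTensor E α v, x⟫_ℂ = ⟪v, coord n E x α⟫_ℂ := by
  rw [← (coord n E).inner_map_map, coord_basisTensor, lp.inner_single_left]

theorem hasSum_norm_coord_sq (x : HilbertTensor (Fock n) E) :
    HasSum (fun α => ‖coord n E x α‖ ^ 2) (‖x‖ ^ 2) := by
  have := lp.hasSum_norm (p := 2) (by norm_num) (coord n E x)
  simpa using this

theorem coord_ext {x y : HilbertTensor (Fock n) E} (h : ∀ α, coord n E x α = coord n E y α) :
    x = y :=
  (coord n E).injective (lp.ext (funext h))

/-- The vectors with only finitely many nonzero coordinates. -/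
def finSupp (n : ℕ) (E : Type*) [NormedAddCommGroup E] [InnerProductSpace ℂ E] [CompleteSpace E] :
    Submodule ℂ (HilbertTensor (Fock n) E) where
  carrier := {x | ∃ N, ∀ α : Word n, N ≤ α.length → coord n E x α = 0}
  zero_mem' := ⟨0, by simp⟩
  add_mem' := by
    rintro x y ⟨N, hN⟩ ⟨M, hM⟩
    exact ⟨max N M, fun α h => by
      simp [hN α (le_of_max_le_left h), hM α (le_of_max_le_right h)]⟩
  smul_mem' := by
    rintro c x ⟨N, hN⟩
    exact ⟨N, fun α h => by simp [hN α h]⟩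

variable (n E) in
theorem dense_finSupp : Dense (finSupp n E : Set (HilbertTensor (Fock n) E)) := by
  rw [Submodule.dense_iff_topologicalClosure_eq_top]
  refine eq_top_of_basisTensor_mem _ (Submodule.isClosed_topologicalClosure _) fun α v => ?_
  refine Submodule.le_topologicalClosure _ ⟨α.length + 1, fun β hβ => ?_⟩
  rw [coord_basisTensor, lp.single_apply_ne]
  rintro rfl
  omega

end Coordinates

/-! ### The operators `W_α ⊗ I` and the row contraction. -/

namespace PositiveRegular

variable {n : ℕ} (f : PositiveRegular n)

theorem Wword_e (α β : Word n) :
    f.Wword α (e β) = ((√(f.b β / f.b (α ++ β)) : ℝ) : ℂ) • e (α ++ β) := by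
  induction α with
  | nil => simp [Wword, (f.b_pos β).ne']
  | cons i α ih =>
    have : f.Wword (i :: α) = f.W i * f.Wword α := by simp [Wword]
    rw [this, ContinuousLinearMap.mul_def, ContinuousLinearMap.comp_apply, ih, map_smul, W_e, smul_smul, ← Complex.ofReal_mul,
      ← Real.sqrt_mul (div_nonneg (f.b_nonneg _) (f.b_nonneg _)),
      div_mul_div_cancel₀ (f.b_pos _).ne', List.cons_append]

variable (E : Type*) [NormedAddCommGroup E] [InnerProductSpace ℂ E]

/-- The operator `W_α ⊗ I_E`. -/
def V (α : Word n) : HilbertTensor (Fock n) E →L[ℂ] HilbertTensor (Fock n) E :=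
  ampliation E (f.Wword α)

theorem V_nil : f.V E [] = ContinuousLinearMap.id ℂ _ := by
  simpa [V, Wword] using ampliation_one

theorem V_append (α β : Word n) : f.V E (α ++ β) = f.V E α ∘L f.V E β := by
  simpa [V, Wword] using ampliation_mul _ _

theorem V_cons (i : Fin n) (α : Word n) :
    f.V E (i :: α) = ampliation E (f.W i) ∘L f.V E α := by
  simpa [V, Wword] using ampliation_mul _ _

variable {E}

theorem V_basisTensor (α β : Word n) (v : E) :
    f.V E α (basisTensor E β v) =
      ((√(f.b β / f.b (α ++ β)) : ℝ) : ℂ) • basisTensor E (α ++ β) v := by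
  rw [basisTensor_apply, V, ampliation_coe_tmul, Wword_e, ← TensorProduct.smul_tmul',
    UniformSpace.Completion.coe_smul, basisTensor_apply]

theorem IsMultiAnalytic.comp_V {f : PositiveRegular n} {H : Type*} [NormedAddCommGroup H]
    [InnerProductSpace ℂ H]
    {Ψ : HilbertTensor (Fock n) E →L[ℂ] HilbertTensor (Fock n) H} (h : f.IsMultiAnalytic Ψ)
    (α : Word n) : Ψ ∘L f.V E α = f.V H α ∘L Ψ := by
  induction α with
  | nil => simp [V_nil]
  | cons i α ih =>
    rw [V_cons, V_cons, ← ContinuousLinearMap.comp_assoc, h i, ContinuousLinearMap.comp_assoc, ih,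
      ContinuousLinearMap.comp_assoc]

theorem adjoint_V_append (α β : Word n) (x : HilbertTensor (Fock n) E) :
    (f.V E (α ++ β)).adjoint x = (f.V E β).adjoint ((f.V E α).adjoint x) := by
  rw [V_append, ContinuousLinearMap.adjoint_comp, ContinuousLinearMap.comp_apply]

variable [CompleteSpace E]

theorem coord_adjoint_V (α β : Word n) (x : HilbertTensor (Fock n) E) :
    coord n E ((f.V E α).adjoint x) β =
      ((√(f.b β / f.b (α ++ β)) : ℝ) : ℂ) • coord n E x (α ++ β) := by
  refine ext_inner_left ℂ fun v => ?_
  rw [← inner_basisTensor, ContinuousLinearMap.adjoint_inner_right, V_basisTensor,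
    inner_smul_left, inner_smul_right, inner_basisTensor, Complex.conj_ofReal]

/-- The adjoint reads only coordinates at words with prefix `α`. Hence sums over words are finite on
finitely supported vectors. -/
theorem adjoint_V_eq_zero {x : HilbertTensor (Fock n) E} {N : ℕ}
    (hx : ∀ α : Word n, N ≤ α.length → coord n E x α = 0) {α : Word n} (hα : N ≤ α.length) :
    (f.V E α).adjoint x = 0 := by
  refine coord_ext fun β => ?_
  rw [coord_adjoint_V, hx _ (by rw [List.length_append]; omega)]
  simp

/-- The row `(√a_α W_α ⊗ I)_α` is a contraction. -/
theorem sum_norm_adjoint_V_sq_le (s : Finset (Word n)) (x : HilbertTensor (Fock n) E) :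
    ∑ α ∈ s, f.a α * ‖(f.V E α).adjoint x‖ ^ 2 ≤ ‖x‖ ^ 2 := by
  have hsum : HasSum (fun β => ∑ α ∈ s, f.a α * ‖coord n E ((f.V E α).adjoint x) β‖ ^ 2)
      (∑ α ∈ s, f.a α * ‖(f.V E α).adjoint x‖ ^ 2) :=
    hasSum_sum fun α _ => (hasSum_norm_coord_sq _).mul_left _
  refine hasSum_le_of_sum_le hsum fun t => ?_
  let g : Word n → Word n → ℝ := fun α β =>
    f.a α * f.b β * (‖coord n E x (α ++ β)‖ ^ 2 / f.b (α ++ β))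
  have hg : ∀ α β, f.a α * ‖coord n E ((f.V E α).adjoint x) β‖ ^ 2 = g α β := by
    intro α β
    rw [coord_adjoint_V, norm_smul, mul_pow, Complex.norm_real, Real.norm_eq_abs, sq_abs,
      Real.sq_sqrt (div_nonneg (f.b_nonneg _) (f.b_nonneg _))]
    simp only [g]
    ring
  have hg0 : ∀ α β, 0 ≤ g α β := fun α β => by
    rw [← hg]
    exact mul_nonneg (f.a_nonneg α) (sq_nonneg _)
  obtain ⟨N, hN⟩ : ∃ N : ℕ, ∀ p ∈ s ×ˢ t, p.1.length + p.2.length < N := by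
    obtain ⟨N, hN⟩ := ((s ×ˢ t).image fun p => p.1.length + p.2.length).bddAbove
    exact ⟨N + 1, fun p hp => Nat.lt_succ_of_le (hN (by
      simpa using ⟨p.1, p.2, by simpa using hp, rfl⟩))⟩
  calc ∑ β ∈ t, ∑ α ∈ s, f.a α * ‖coord n E ((f.V E α).adjoint x) β‖ ^ 2
      = ∑ p ∈ s ×ˢ t, g p.1 p.2 := by
        rw [Finset.sum_comm, Finset.sum_product]
        exact Finset.sum_congr rfl fun α _ => Finset.sum_congr rfl fun β _ => hg α β
    _ ≤ ∑ p ∈ (wordsLT n N ×ˢ wordsLT n N).filter (fun p => p.1.length + p.2.length < N),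
          g p.1 p.2 := by
        refine Finset.sum_le_sum_of_subset_of_nonneg (fun p hp => ?_) fun p _ _ => hg0 _ _
        have := hN p hp
        simp
        omega
    _ = ∑ δ ∈ wordsLT n N, ∑ k ∈ Finset.range (δ.length + 1), g (δ.take k) (δ.drop k) :=
        (sum_wordsLT_splits N g).symm
    -- For fixed `δ` the factor `‖x_δ‖² / b_δ` is common to all splittings, and the remaining sum of
    -- `a_α b_β` is `b_δ`, or `0` at the empty word.
    _ ≤ ∑ δ ∈ wordsLT n N, ‖coord n E x δ‖ ^ 2 := by
        refine Finset.sum_le_sum fun δ _ => ?_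
        simp only [g, List.take_append_drop, ← Finset.sum_mul, sum_splits_first]
        split_ifs
        · simp
        · rw [mul_div_cancel₀ _ (f.b_pos δ).ne']
    _ ≤ ‖x‖ ^ 2 := sum_le_hasSum _ (fun _ _ => sq_nonneg _) (hasSum_norm_coord_sq x)

end PositiveRegular

/-! ### Column operators into `ℓ²`. -/

section Column

variable {ι K G : Type*} [NormedAddCommGroup K] [InnerProductSpace ℂ K]
  [NormedAddCommGroup G] [InnerProductSpace ℂ G]

/-- The column operator `x ↦ (A_i x)_i` of a square summable family of operators. -/
def column (A : ι → K →L[ℂ] G) {C : ℝ} (hC : 0 ≤ C)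
    (h : ∀ (s : Finset ι) (x : K), ∑ i ∈ s, ‖A i x‖ ^ 2 ≤ (C * ‖x‖) ^ 2) :
    K →L[ℂ] lp (fun _ : ι => G) 2 :=
  LinearMap.mkContinuous
    { toFun := fun x => ⟨fun i => A i x, memℓp_gen' (C := (C * ‖x‖) ^ 2) fun s => by
        simpa using h s x⟩
      map_add' := fun x y => lp.ext (funext fun i => map_add (A i) x y)
      map_smul' := fun c x => lp.ext (funext fun i => map_smul (A i) c x) }
    C fun x => lp.norm_le_of_forall_sum_le (by norm_num) (by positivity) fun s => by
      simpa using h s x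

theorem column_apply {A : ι → K →L[ℂ] G} {C : ℝ} {hC : 0 ≤ C}
    {h : ∀ (s : Finset ι) (x : K), ∑ i ∈ s, ‖A i x‖ ^ 2 ≤ (C * ‖x‖) ^ 2} (x : K) (i : ι) :
    column A hC h x i = A i x := rfl

/-- The identity on the dense set already bounds every partial sum by `‖Y‖ ‖x‖²`, so the column is
bounded with constant `√‖Y‖`, and the identity extends by continuity. -/
theorem exists_column_factorization [CompleteSpace K] [CompleteSpace G] {A : ι → K →L[ℂ] G}
    {Y : K →L[ℂ] K} {S : Set K} (hS : Dense S)
    (h : ∀ x ∈ S, ∀ s : Finset ι, ∃ t, s ⊆ t ∧ (∀ i ∉ t, A i x = 0) ∧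
      ∑ i ∈ t, ⟪A i x, A i x⟫_ℂ = ⟪x, Y x⟫_ℂ) :
    ∃ T : K →L[ℂ] lp (fun _ : ι => G) 2,
      (∀ x i, T x i = A i x) ∧ ∀ x, ⟪T x, T x⟫_ℂ = ⟪x, Y x⟫_ℂ := by
  have hbound : ∀ (s : Finset ι) x, ∑ i ∈ s, ‖A i x‖ ^ 2 ≤ (√‖Y‖ * ‖x‖) ^ 2 := by
    intro s
    refine hS.induction (fun x hx => ?_) (isClosed_le (by fun_prop) (by fun_prop))
    obtain ⟨t, hst, -, ht⟩ := h x hx s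
    calc ∑ i ∈ s, ‖A i x‖ ^ 2 ≤ ∑ i ∈ t, ‖A i x‖ ^ 2 :=
          Finset.sum_le_sum_of_subset_of_nonneg hst fun _ _ _ => sq_nonneg _
      _ ≤ ‖∑ i ∈ t, ⟪A i x, A i x⟫_ℂ‖ := by
          refine le_trans (le_of_eq ?_) (Complex.re_le_norm _)
          rw [Complex.re_sum]
          exact Finset.sum_congr rfl fun i _ => (inner_self_eq_norm_sq (𝕜 := ℂ) _).symm
      _ = ‖⟪x, Y x⟫_ℂ‖ := by rw [ht]
      _ ≤ ‖x‖ * (‖Y‖ * ‖x‖) :=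
          (norm_inner_le_norm _ _).trans
            (mul_le_mul_of_nonneg_left (Y.le_opNorm x) (norm_nonneg x))
      _ = (√‖Y‖ * ‖x‖) ^ 2 := by
          rw [mul_pow, Real.sq_sqrt (norm_nonneg _)]
          ring
  refine ⟨column A (Real.sqrt_nonneg ‖Y‖) hbound, fun _ _ => rfl, ?_⟩
  refine hS.induction (fun x hx => ?_) (isClosed_eq (by fun_prop) (by fun_prop))
  obtain ⟨t, -, h0, ht⟩ := h x hx ∅
  rw [← ht]
  refine (lp.hasSum_inner (𝕜 := ℂ) (column A (Real.sqrt_nonneg ‖Y‖) hbound x) _).unique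
    (hasSum_sum_of_ne_finset_zero fun i hi => ?_)
  simp only [column_apply, h0 i hi, inner_zero_left]

end Column

/-! ### Auxiliary facts on Hilbert space operators. -/

section HilbertSpace

variable {K L : Type*} [NormedAddCommGroup K] [InnerProductSpace ℂ K]
  [NormedAddCommGroup L] [InnerProductSpace ℂ L]

theorem exists_eq_adjoint_comp_self [CompleteSpace K] {T : K →L[ℂ] K} (hT : 0 ≤ T) :
    ∃ R : K →L[ℂ] K, T = R.adjoint ∘L R :=
  CStarAlgebra.nonneg_iff_eq_star_mul_self.1 hT

theorem eq_adjoint_comp_self [CompleteSpace K] [CompleteSpace L] {Y : K →L[ℂ] K} {B : K →L[ℂ] L}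
    (h : ∀ x, ⟪B x, B x⟫_ℂ = ⟪x, Y x⟫_ℂ) : Y = B.adjoint ∘L B := by
  refine ContinuousLinearMap.coe_injective ((ext_inner_map _ _).1 fun x => ?_)
  change ⟪Y x, x⟫_ℂ = ⟪B.adjoint (B x), x⟫_ℂ
  rw [← inner_conj_symm, ← h, inner_conj_symm, ContinuousLinearMap.adjoint_inner_left]

theorem adjoint_comp_eq_comp_adjoint [CompleteSpace K] [CompleteSpace L] {B : K →L[ℂ] L}
    {P : K →L[ℂ] K} {Q : L →L[ℂ] L} (h : ∀ x, Q.adjoint (B x) = B (P.adjoint x)) :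
    B.adjoint ∘L Q = P ∘L B.adjoint := by
  ext y
  refine ext_inner_right ℂ fun x => ?_
  rw [ContinuousLinearMap.comp_apply, ContinuousLinearMap.comp_apply,
    ContinuousLinearMap.adjoint_inner_left, ← ContinuousLinearMap.adjoint_inner_right Q,
    ← ContinuousLinearMap.adjoint_inner_right P, ContinuousLinearMap.adjoint_inner_left, h]

theorem inner_sum_apply_wot {ι : Type*} (s : Finset ι) (F : ι → K →WOT[ℂ] K) (x y : K) :
    ⟪y, (∑ i ∈ s, F i) x⟫_ℂ = ∑ i ∈ s, ⟪y, F i x⟫_ℂ := by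
  classical
  induction s using Finset.induction_on with
  | empty => simp
  | insert i s hi ih =>
    rw [Finset.sum_insert hi, Finset.sum_insert hi, ContinuousLinearMapWOT.add_apply,
      inner_add_right, ih]

theorem exists_coord_apply_eq {n : ℕ} [CompleteSpace L]
    (T : K →L[ℂ] lp (fun _ : Word n => L) 2) :
    ∃ B : K →L[ℂ] HilbertTensor (Fock n) L, ∀ x, coord n L (B x) = T x :=
  ⟨(coord n L).symm.toLinearIsometry.toContinuousLinearMap ∘L T,
    fun x => (coord n L).apply_symm_apply (T x)⟩

end HilbertSpace

/-! ### The map `Φ` and the factorization of `Y`. -/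

namespace PositiveRegular

variable {n : ℕ} (f : PositiveRegular n) {H : Type*} [NormedAddCommGroup H]
  [InnerProductSpace ℂ H]
  (Y : HilbertTensor (Fock n) H →L[ℂ] HilbertTensor (Fock n) H)

theorem inner_PhiTerm (α : Word n) (x y : HilbertTensor (Fock n) H) :
    ⟪y, f.PhiTerm Y α x⟫_ℂ =
      (f.a α : ℂ) * ⟪(f.V H α).adjoint y, Y ((f.V H α).adjoint x)⟫_ℂ := by
  rw [ContinuousLinearMap.adjoint_inner_left, ← inner_smul_right]
  rfl

variable [CompleteSpace H]

theorem exists_hasSum_PhiTerm : ∃ T, HasSum (f.PhiTerm Y) T := by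
  let R : Word n → HilbertTensor (Fock n) H →L[ℂ] HilbertTensor (Fock n) H := fun α =>
    ((√(f.a α) : ℝ) : ℂ) • (f.V H α).adjoint
  have hR : ∀ α x, ‖R α x‖ ^ 2 = f.a α * ‖(f.V H α).adjoint x‖ ^ 2 := fun α x => by
    simp only [R, smul_apply]
    rw [norm_smul, mul_pow, Complex.norm_real, Real.norm_eq_abs, sq_abs,
      Real.sq_sqrt (f.a_nonneg α)]
  have h1 : ∀ (s : Finset (Word n)) x, ∑ α ∈ s, ‖R α x‖ ^ 2 ≤ (1 * ‖x‖) ^ 2 := fun s x => by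
    simpa only [hR, one_mul] using f.sum_norm_adjoint_V_sq_le s x
  have h2 : ∀ (s : Finset (Word n)) x, ∑ α ∈ s, ‖(Y ∘L R α) x‖ ^ 2 ≤ (‖Y‖ * ‖x‖) ^ 2 := by
    intro s x
    calc ∑ α ∈ s, ‖(Y ∘L R α) x‖ ^ 2 ≤ ∑ α ∈ s, ‖Y‖ ^ 2 * ‖R α x‖ ^ 2 := by
          refine Finset.sum_le_sum fun α _ => ?_
          rw [← mul_pow]
          exact pow_le_pow_left₀ (norm_nonneg _) (Y.le_opNorm _) 2
      _ ≤ (‖Y‖ * ‖x‖) ^ 2 := by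
          rw [← Finset.mul_sum, mul_pow]
          exact mul_le_mul_of_nonneg_left (by simpa using h1 s x) (sq_nonneg _)
  -- The limit is `C^* (I ⊗ Y) C`, where `C` is the contractive column of the `√a_α V_α^*`; its
  -- matrix entries are inner products in `ℓ²`, hence convergent sums.
  refine ⟨.ofCLM ((column R zero_le_one h1).adjoint ∘L
    column (fun α => Y ∘L R α) (norm_nonneg Y) h2), ?_⟩
  refine ContinuousLinearMapWOT.tendsto_iff_forall_inner_apply_tendsto.2 fun x y => ?_
  have hsum := lp.hasSum_inner (𝕜 := ℂ) (column R zero_le_one h1 y)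
    (column (fun α => Y ∘L R α) (norm_nonneg Y) h2 x)
  rw [← ContinuousLinearMap.adjoint_inner_right] at hsum
  refine Filter.Tendsto.congr (fun s => ?_) hsum
  rw [inner_sum_apply_wot]
  refine Finset.sum_congr rfl fun α _ => ?_
  rw [inner_PhiTerm]
  change ⟪R α y, (Y ∘L R α) x⟫_ℂ = _
  simp only [R, smul_apply, ContinuousLinearMap.comp_apply, map_smul,
    inner_smul_left, inner_smul_right, Complex.conj_ofReal, ← mul_assoc, ← Complex.ofReal_mul,
    Real.mul_self_sqrt (f.a_nonneg α)]

theorem hasSum_inner_Phi (x y : HilbertTensor (Fock n) H) :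
    HasSum (fun α => (f.a α : ℂ) * ⟪(f.V H α).adjoint y, Y ((f.V H α).adjoint x)⟫_ℂ)
      ⟪y, f.Phi Y x⟫_ℂ := by
  obtain ⟨T, hT⟩ := f.exists_hasSum_PhiTerm Y
  have hPhi : f.Phi Y = T.toCLM := by rw [Phi, hT.tsum_eq]
  rw [hPhi]
  refine Filter.Tendsto.congr (fun s => ?_)
    (ContinuousLinearMapWOT.tendsto_iff_forall_inner_apply_tendsto.1 hT x y)
  rw [inner_sum_apply_wot]
  exact Finset.sum_congr rfl fun α _ => f.inner_PhiTerm Y α x y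

/-- Reduces the operator inequality to finite sums of norms; it serves both `B = Ψ^*` and `B` an
orthogonal projection. -/
theorem Phi_adjoint_comp_self_le {G : Type*} [NormedAddCommGroup G] [InnerProductSpace ℂ G]
    [CompleteSpace G] (B : HilbertTensor (Fock n) H →L[ℂ] G)
    (h : ∀ (s : Finset (Word n)) x,
      ∑ α ∈ s, f.a α * ‖B ((f.V H α).adjoint x)‖ ^ 2 ≤ ‖B x‖ ^ 2) :
    f.Phi (B.adjoint ∘L B) ≤ B.adjoint ∘L B := by
  have hB : ∀ x, ⟪x, (B.adjoint ∘L B) x⟫_ℂ = ((‖B x‖ ^ 2 : ℝ) : ℂ) := fun x => by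
    rw [ContinuousLinearMap.comp_apply, ContinuousLinearMap.adjoint_inner_right,
      inner_self_eq_norm_sq_to_K]
    simp
  rw [ContinuousLinearMap.le_def, ContinuousLinearMap.isPositive_iff_complex]
  intro x
  have hs : Summable fun α => f.a α * ‖B ((f.V H α).adjoint x)‖ ^ 2 :=
    summable_of_sum_le (fun α => mul_nonneg (f.a_nonneg α) (sq_nonneg _)) (fun s => h s x)
  have hle := hs.tsum_le_of_sum_le fun s => h s x
  have hPhi := f.hasSum_inner_Phi (B.adjoint ∘L B) x x
  simp only [hB, ← Complex.ofReal_mul] at hPhi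
  have hr := hPhi.unique (Complex.hasSum_ofReal.2 hs.hasSum)
  have key : ⟪x, (B.adjoint ∘L B - f.Phi (B.adjoint ∘L B)) x⟫_ℂ =
      ((‖B x‖ ^ 2 - ∑' α, f.a α * ‖B ((f.V H α).adjoint x)‖ ^ 2 : ℝ) : ℂ) := by
    rw [sub_apply, inner_sub_right, hr, hB, Complex.ofReal_sub]
  rw [← inner_conj_symm, key, Complex.conj_ofReal]
  exact ⟨rfl, sub_nonneg.2 hle⟩

theorem Phi_comp_adjoint_le {E : Type*} [NormedAddCommGroup E] [InnerProductSpace ℂ E]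
    [CompleteSpace E] {Ψ : HilbertTensor (Fock n) E →L[ℂ] HilbertTensor (Fock n) H}
    (hΨ : f.IsMultiAnalytic Ψ) : f.Phi (Ψ ∘L Ψ.adjoint) ≤ Ψ ∘L Ψ.adjoint := by
  suffices h : ∀ (s : Finset (Word n)) x,
      ∑ α ∈ s, f.a α * ‖Ψ.adjoint ((f.V H α).adjoint x)‖ ^ 2 ≤ ‖Ψ.adjoint x‖ ^ 2 by
    simpa only [ContinuousLinearMap.adjoint_adjoint] using
      f.Phi_adjoint_comp_self_le Ψ.adjoint h
  · intro s x
    have h : ∀ α, Ψ.adjoint ((f.V H α).adjoint x) = (f.V E α).adjoint (Ψ.adjoint x) := fun α => by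
      rw [← ContinuousLinearMap.comp_apply, ← ContinuousLinearMap.adjoint_comp, ← hΨ.comp_V,
        ContinuousLinearMap.adjoint_comp, ContinuousLinearMap.comp_apply]
    simpa only [h] using f.sum_norm_adjoint_V_sq_le s (Ψ.adjoint x)

/-- On vectors with finitely many coordinates, `Y` is recovered from `Y - Φ(Y)` by inverting
`id - Φ`. -/
theorem sum_b_mul_inner_sub_Phi {x : HilbertTensor (Fock n) H} {N : ℕ} (hN : 0 < N)
    (hx : ∀ α : Word n, N ≤ α.length → coord n H x α = 0) :
    ∑ α ∈ wordsLT n N,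
        (f.b α : ℂ) * ⟪(f.V H α).adjoint x, (Y - f.Phi Y) ((f.V H α).adjoint x)⟫_ℂ =
      ⟪x, Y x⟫_ℂ := by
  let q : Word n → ℂ := fun α => ⟪(f.V H α).adjoint x, Y ((f.V H α).adjoint x)⟫_ℂ
  have hq : ∀ α : Word n, N ≤ α.length → q α = 0 := fun α hα => by
    simp only [q, f.adjoint_V_eq_zero hx hα, inner_zero_left]
  have hd : ∀ α, ⟪(f.V H α).adjoint x, (Y - f.Phi Y) ((f.V H α).adjoint x)⟫_ℂ =
      q α - ∑ β ∈ wordsLT n N, (f.a β : ℂ) * q (α ++ β) := fun α => by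
    rw [sub_apply, inner_sub_right]
    congr 1
    refine (f.hasSum_inner_Phi Y _ _).unique ?_
    simp only [← adjoint_V_append]
    refine hasSum_sum_of_ne_finset_zero fun β hβ => ?_
    rw [mem_wordsLT, not_lt] at hβ
    rw [f.adjoint_V_eq_zero hx (by rw [List.length_append]; omega), inner_zero_left, mul_zero]
  -- Pairs with `|α| + |β| ≥ N` contribute nothing; the others are regrouped by `δ = αβ`, where `b *
  -- a` equals `b` off the empty word. After subtraction only the empty word survives.
  have hsplit : ∑ α ∈ wordsLT n N, ∑ β ∈ wordsLT n N,
      (f.b α : ℂ) * ((f.a β : ℂ) * q (α ++ β)) =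
      ∑ δ ∈ wordsLT n N, if δ = [] then 0 else (f.b δ : ℂ) * q δ := by
    rw [← Finset.sum_product' (f := fun α β => (f.b α : ℂ) * ((f.a β : ℂ) * q (α ++ β))),
      ← Finset.sum_subset (Finset.filter_subset (fun p => p.1.length + p.2.length < N) _),
      ← sum_wordsLT_splits N (fun α β => (f.b α : ℂ) * ((f.a β : ℂ) * q (α ++ β)))]
    · refine Finset.sum_congr rfl fun δ _ => ?_
      have := congrArg (fun r : ℝ => (r : ℂ) * q δ) (f.sum_splits_last δ)
      simp only [List.take_append_drop, ← mul_assoc, ← Finset.sum_mul]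
      push_cast at this
      rw [this]
      split_ifs <;> simp
    · intro p hp hp'
      have : N ≤ p.1.length + p.2.length := by
        by_contra hlt
        exact hp' (Finset.mem_filter.2 ⟨hp, not_le.1 hlt⟩)
      rw [hq _ (by rw [List.length_append]; exact this)]
      simp
  simp only [hd, mul_sub, Finset.mul_sum, Finset.sum_sub_distrib]
  rw [hsplit, ← Finset.sum_sub_distrib, Finset.sum_eq_single []]
  · simp [f.b_nil, q, V_nil, ContinuousLinearMap.adjoint_id]
  · intro δ _ hδ
    simp [hδ]
  · intro h
    exact absurd (mem_wordsLT.2 (by simpa using hN)) h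

theorem V_singleton (E : Type*) [NormedAddCommGroup E] [InnerProductSpace ℂ E] (i : Fin n) :
    f.V E [i] = ampliation E (f.W i) := by
  simp [V, Wword]

/-- `B` is a weighted Poisson-type kernel: its `α`-coordinate is `√b_α R V_α^*`. -/
theorem exists_isMultiAnalytic_adjoint_of_sub_Phi_eq {Y} {G : Type*} [NormedAddCommGroup G]
    [InnerProductSpace ℂ G] [CompleteSpace G] {R : HilbertTensor (Fock n) H →L[ℂ] G}
    (hR : Y - f.Phi Y = R.adjoint ∘L R) :
    ∃ B : HilbertTensor (Fock n) H →L[ℂ] HilbertTensor (Fock n) G,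
      f.IsMultiAnalytic B.adjoint ∧ Y = B.adjoint ∘L B := by
  let A : Word n → HilbertTensor (Fock n) H →L[ℂ] G := fun α =>
    ((√(f.b α) : ℝ) : ℂ) • (R ∘L (f.V H α).adjoint)
  have hA : ∀ α x, A α x = ((√(f.b α) : ℝ) : ℂ) • R ((f.V H α).adjoint x) := fun _ _ => rfl
  have hAA : ∀ α x, ⟪A α x, A α x⟫_ℂ =
      (f.b α : ℂ) * ⟪(f.V H α).adjoint x, (Y - f.Phi Y) ((f.V H α).adjoint x)⟫_ℂ := fun α x => by
    rw [hR, ContinuousLinearMap.comp_apply, ContinuousLinearMap.adjoint_inner_right, hA,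
      inner_smul_left, inner_smul_right, Complex.conj_ofReal, ← mul_assoc, ← Complex.ofReal_mul,
      Real.mul_self_sqrt (f.b_nonneg α)]
  have hfin : ∀ x ∈ finSupp n H, ∀ s : Finset (Word n), ∃ t, s ⊆ t ∧
      (∀ α ∉ t, A α x = 0) ∧ ∑ α ∈ t, ⟪A α x, A α x⟫_ℂ = ⟪x, Y x⟫_ℂ := by
    rintro x ⟨N, hN⟩ s
    obtain ⟨M, hM⟩ := (s.image List.length).bddAbove
    -- `M` makes the set contain `s`, `N` makes the omitted terms vanish, and `+ 1` admits words of
    -- length exactly `M` and keeps the bound positive.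
    refine ⟨wordsLT n (max N M + 1), fun α hα => ?_, fun α hα => ?_, ?_⟩
    · have : α.length ≤ M := hM (Finset.mem_coe.2 (Finset.mem_image_of_mem _ hα))
      rw [mem_wordsLT]
      omega
    · rw [mem_wordsLT] at hα
      rw [hA, f.adjoint_V_eq_zero hN (by omega), map_zero, smul_zero]
    · simp only [hAA]
      exact f.sum_b_mul_inner_sub_Phi Y (by omega) fun α hα => hN α (by omega)
  obtain ⟨T, hTA, hT⟩ := exists_column_factorization (dense_finSupp n H) hfin
  obtain ⟨B, hBT⟩ := exists_coord_apply_eq T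
  have hB : ∀ x α, coord n _ (B x) α = A α x := fun x α => by rw [hBT, hTA]
  refine ⟨B, fun i => ?_, ?_⟩
  · refine adjoint_comp_eq_comp_adjoint fun x => coord_ext fun β => ?_
    -- The weights cancel: `√(b_β / b_{iβ}) √b_{iβ} = √b_β`.
    rw [← V_singleton, ← V_singleton, coord_adjoint_V, hB, hB, hA, hA, adjoint_V_append, smul_smul,
      ← Complex.ofReal_mul, ← Real.sqrt_mul (div_nonneg (f.b_nonneg _) (f.b_nonneg _)),
      div_mul_cancel₀ _ (f.b_pos _).ne']
  · refine eq_adjoint_comp_self fun x => ?_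
    rw [← hT]
    exact ((coord n _).inner_map_map (B x) (B x)).symm.trans (by rw [hBT])

theorem exists_isMultiAnalytic_adjoint (hY : f.Phi Y ≤ Y) :
    ∃ B : HilbertTensor (Fock n) H →L[ℂ] HilbertTensor (Fock n) (HilbertTensor (Fock n) H),
      f.IsMultiAnalytic B.adjoint ∧ Y = B.adjoint ∘L B :=
  let ⟨_, hR⟩ := exists_eq_adjoint_comp_self (sub_nonneg.2 hY)
  f.exists_isMultiAnalytic_adjoint_of_sub_Phi_eq hR

theorem Phi_starProjection_le (M : Submodule ℂ (HilbertTensor (Fock n) H))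
    [M.HasOrthogonalProjection] (hM : ∀ i, ∀ x ∈ M, ampliation H (f.W i) x ∈ M) :
    f.Phi M.starProjection ≤ M.starProjection := by
  have hV : ∀ α, ∀ x ∈ M, f.V H α x ∈ M := by
    intro α
    induction α with
    | nil => simp [V_nil]
    | cons i α ih =>
      intro x hx
      rw [V_cons]
      exact hM i _ (ih x hx)
  -- Invariance of `M` under `V_α` in adjoint form, `P V_α^* = P V_α^* P`, so the row contraction
  -- estimate can be applied to `P x`.
  have hP : ∀ α x, M.starProjection ((f.V H α).adjoint x) =
      M.starProjection ((f.V H α).adjoint (M.starProjection x)) := by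
    intro α x
    refine ext_inner_left ℂ fun y => ?_
    simp only [← Submodule.inner_starProjection_left_eq_right,
      ContinuousLinearMap.adjoint_inner_right]
    rw [Submodule.starProjection_eq_self_iff.2 (hV α _ (M.starProjection_apply_mem y))]
  have hPP : M.starProjection.adjoint ∘L M.starProjection = M.starProjection := by
    rw [← ContinuousLinearMap.star_eq_adjoint, (isSelfAdjoint_starProjection M).star_eq]
    exact M.isIdempotentElem_starProjection
  suffices h : ∀ (s : Finset (Word n)) x,
      ∑ α ∈ s, f.a α * ‖M.starProjection ((f.V H α).adjoint x)‖ ^ 2 ≤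
        ‖M.starProjection x‖ ^ 2 by
    simpa only [hPP] using f.Phi_adjoint_comp_self_le M.starProjection h
  · intro s x
    refine le_trans (Finset.sum_le_sum fun α _ => ?_)
      (f.sum_norm_adjoint_V_sq_le s (M.starProjection x))
    rw [hP]
    exact mul_le_mul_of_nonneg_left
      (pow_le_pow_left₀ (norm_nonneg _) (M.norm_starProjection_apply_le _) 2) (f.a_nonneg α)

end PositiveRegular

/-! ### Factorizations of an orthogonal projection. -/

section PartialIsometry

variable {K L : Type*} [NormedAddCommGroup K] [InnerProductSpace ℂ K] [CompleteSpace K]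
  [NormedAddCommGroup L] [InnerProductSpace ℂ L] [CompleteSpace L]
  {M : Submodule ℂ K} [M.HasOrthogonalProjection] {B : K →L[ℂ] L}

theorem norm_apply_of_adjoint_comp_eq_starProjection (h : M.starProjection = B.adjoint ∘L B)
    (x : K) : ‖B x‖ = ‖M.starProjection x‖ := by
  have h1 : ⟪B x, B x⟫_ℂ = ⟪M.starProjection x, M.starProjection x⟫_ℂ := by
    rw [← ContinuousLinearMap.adjoint_inner_right, ← ContinuousLinearMap.comp_apply, ← h,
      Submodule.inner_starProjection_left_eq_right,
      Submodule.starProjection_eq_self_iff.2 (M.starProjection_apply_mem x)]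
  rw [inner_self_eq_norm_sq_to_K, inner_self_eq_norm_sq_to_K] at h1
  exact (sq_eq_sq₀ (norm_nonneg _) (norm_nonneg _)).1 (by exact_mod_cast h1)

theorem range_adjoint_of_adjoint_comp_eq_starProjection
    (h : M.starProjection = B.adjoint ∘L B) :
    M = LinearMap.range B.adjoint.toLinearMap := by
  refine le_antisymm (fun x hx => LinearMap.mem_range.2 ⟨B x, ?_⟩) ?_
  · change (B.adjoint ∘L B) x = x
    rw [← h]
    exact Submodule.starProjection_eq_self_iff.2 hx
  · rintro _ ⟨y, rfl⟩
    rw [← Submodule.starProjection_eq_self_iff]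
    refine ext_inner_left ℂ fun z => ?_
    change ⟪z, M.starProjection (B.adjoint y)⟫_ℂ = ⟪z, B.adjoint y⟫_ℂ
    rw [← Submodule.inner_starProjection_left_eq_right, ContinuousLinearMap.adjoint_inner_right,
      ContinuousLinearMap.adjoint_inner_right, ← sub_eq_zero, ← inner_sub_left, ← map_sub]
    -- `‖B x‖ = ‖P x‖`, so `B` kills the orthogonal complement of `M`; this places the range of
    -- `B^*` inside `M`.
    have : B (M.starProjection z - z) = 0 := by
      rw [← norm_eq_zero, norm_apply_of_adjoint_comp_eq_starProjection h, map_sub,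
        Submodule.starProjection_eq_self_iff.2 (M.starProjection_apply_mem z), sub_self,
        norm_zero]
    rw [this, inner_zero_left]

theorem norm_adjoint_apply_of_adjoint_comp_eq_starProjection
    (h : M.starProjection = B.adjoint ∘L B) (x : L)
    (hx : x ∈ (LinearMap.ker B.adjoint.toLinearMap)ᗮ) : ‖B.adjoint x‖ = ‖x‖ := by
  rw [ContinuousLinearMap.orthogonal_ker, ContinuousLinearMap.adjoint_adjoint] at hx
  -- The orthogonal complement of `ker B^*` is the closure of the range of `B`, so vectors `B y`
  -- suffice; there `‖B^* B y‖ = ‖P y‖ = ‖B y‖`.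
  refine closure_minimal ?_ (isClosed_eq (f := fun x => ‖B.adjoint x‖) (by fun_prop)
    continuous_norm) hx
  rintro _ ⟨y, rfl⟩
  change ‖(B.adjoint ∘L B) y‖ = ‖B y‖
  rw [← h, norm_apply_of_adjoint_comp_eq_starProjection h]

end PartialIsometry

end NCDomain

end

theorem mainTheorem9 {n : ℕ} (hn : 1 ≤ n) (f : NCDomain.PositiveRegular n)
    (H : Type u) [NormedAddCommGroup H] [InnerProductSpace ℂ H] [CompleteSpace H] :
    -- the series defining `Φ_{f, W ⊗ I}(Y)` converges in the weak operator topology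
    (∀ Y : NCDomain.HilbertTensor (NCDomain.Fock n) H →L[ℂ]
        NCDomain.HilbertTensor (NCDomain.Fock n) H, Summable (f.PhiTerm Y)) ∧
    -- the factorization criterion
    (∀ Y : NCDomain.HilbertTensor (NCDomain.Fock n) H →L[ℂ]
        NCDomain.HilbertTensor (NCDomain.Fock n) H,
      (∃ (E : Type u) (_ : NormedAddCommGroup E) (_ : InnerProductSpace ℂ E)
          (_ : CompleteSpace E)
          (Ψ : NCDomain.HilbertTensor (NCDomain.Fock n) E →L[ℂ]
            NCDomain.HilbertTensor (NCDomain.Fock n) H),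
          f.IsMultiAnalytic Ψ ∧ Y = Ψ ∘L ContinuousLinearMap.adjoint Ψ) ↔
        f.Phi Y ≤ Y) ∧
    -- the description of the invariant (closed) subspaces
    (∀ M : Submodule ℂ (NCDomain.HilbertTensor (NCDomain.Fock n) H),
      IsClosed (M : Set (NCDomain.HilbertTensor (NCDomain.Fock n) H)) →
      ((∀ i : Fin n, ∀ x ∈ M, NCDomain.ampliation H (f.W i) x ∈ M) ↔
        ∃ (E : Type u) (_ : NormedAddCommGroup E) (_ : InnerProductSpace ℂ E)
          (_ : CompleteSpace E)
          (Ψ : NCDomain.HilbertTensor (NCDomain.Fock n) E →L[ℂ]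
            NCDomain.HilbertTensor (NCDomain.Fock n) H),
          f.IsInner Ψ ∧ M = LinearMap.range Ψ.toLinearMap)) := by
  refine ⟨fun Y => ?_, fun Y => ⟨?_, fun hY => ?_⟩, fun M hM => ⟨fun hinv => ?_, ?_⟩⟩
  · obtain ⟨T, hT⟩ := f.exists_hasSum_PhiTerm Y
    exact hT.summable
  · rintro ⟨E, _, _, _, Ψ, hΨ, rfl⟩
    exact f.Phi_comp_adjoint_le hΨ
  · obtain ⟨B, hB, hYB⟩ := f.exists_isMultiAnalytic_adjoint Y hY
    exact ⟨_, _, _, inferInstance, B.adjoint, hB, by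
      rw [ContinuousLinearMap.adjoint_adjoint, hYB]⟩
  · have : CompleteSpace M := hM.completeSpace_coe
    obtain ⟨B, hB, hMB⟩ := f.exists_isMultiAnalytic_adjoint _ (f.Phi_starProjection_le M hinv)
    exact ⟨_, _, _, inferInstance, B.adjoint,
      ⟨hB, NCDomain.norm_adjoint_apply_of_adjoint_comp_eq_starProjection hMB⟩,
      NCDomain.range_adjoint_of_adjoint_comp_eq_starProjection hMB⟩
  · rintro ⟨E, _, _, _, Ψ, hΨ, rfl⟩ i _ ⟨y, rfl⟩
    exact ⟨NCDomain.ampliation E (f.W i) y, DFunLike.congr_fun (hΨ.1 i) y⟩
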